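/- **Setting.** Let $(\Omega,\mathcal F,P)$ be a probability space with a measure-preserving map $\psi:\Omega\to\Omega$, let $A$ be a compact subset of a Polish space $M$, and let $T:\Omega\times A\to A$ be measurable. Let $T^n(\omega,x)$ ($T^0=\mathrm{id}$, $T^{n+1}(\omega,x)=T(\psi^n\omega,T^n(\omega,x))$) be the generated discrete-time random dynamical system on $A$, with stochastic Koopman operators $\mathcal K^k g(x)=\mathbb E[g(T^k(\omega,x))]$, $\mathcal K=\mathcal K^1$. Assume: * the system is ergodic with respect to an invariant measure $\nu$, i.e. $\nu$ is a probability measure on $\Omega\times A$ with first marginal $P$, the skew product $\Theta(\omega,x)=(\psi\omega,T(\omega,x))$ preserves $\nu$ and is ergodic for it, and $\psi$ is ergodic for $P$; $\mu$ denotes the marginal of $\nu$ on $A$; * the processes $(T^n(\cdot,x))_{n\ge0}$, $x\in A$, form a time-homogeneous Markov family: for all $x\in A$, $s,t\ge0$ and Borel $B\subseteq A$, almost surely $P(T^{s+t}(\cdot,x)\in B\mid T^u(\cdot,x),u\le s)=p_t(T^s(\cdot,x),B)$, where $p_t(y,B)=P(T^t(\cdot,y)\in B)$; * $f:A\to\mathbb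 C$ is measurable, and for $k<m$ the expectation $\mathcal K^kf(x)$ exists for $\mu$-a.e. $x$ and $\mathcal K^kf\in L^2(A,\mu)$; * the Krylov space $V=\operatorname{span}\{f,\mathcal Kf,\dots,\mathcal K^{m-1}f\}\subseteq L^2(A,\mu)$ has dimension $r<m$ and is invariant under $\mathcal K$, i.e. $g\mapsto\mathcal Kg$ is (independently of the measurable representative $g$) a well-defined linear map $\mathcal K|_V:V\to V$. For $(\omega,x)$ and $n\ge1$ let $H_n=\big(\mathcal K^{j}f(T^{i}(\omega,x))\big)_{0\le i<n,\,0\le j\le r}$ be the first $r+1$ columns of the $n\times(m+1)$ stochastic Hankel matrix, let $X_n$ be its first $r$ columns and $Y_n$ its last $r$ columns. The DMD algorithm takes a singular value decomposition $X_n=U_n\Sigma_nW_n^*$ ($U_n$ of size $n\times r$ with orthonormal columns, $\Sigma_n$ diagonal with nonincreasing nonnegative entries, $W_n$ unitary of size $r\times r$) and $S_n=U_n^*Y_nW_n\Sigma_n^{-1}$. The DMD eigenvalues are the eigenvalues of $S_n$; an eigenvector $w$ of $S_n$ gives the Ritz vector $U_nw$ and the DMD eigenfunction $\phi_{n,w}=\sum_{j<r}(W_n\Sigma_n^{-1}w)_j\,\mathcal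 K^jf$. **Conclusion.** For $\nu$-almost every $(\omega,x)$ the following holds. 1. For all sufficiently large $n$ such decompositions exist, and the singular values of $X_n$ are all positive. 2. For every choice of the singular value decompositions, the DMD eigenvalues, counted with algebraic multiplicity and suitably enumerated, converge as $n\to\infty$ to the eigenvalues of $\mathcal K|_V$, counted with algebraic multiplicity. 3. For every choice of the singular value decompositions, for all large $n$ and all $w\in\mathbb C^r$, $\phi_{n,w}(T^k(\omega,x))=(U_nw)_k$ for $0\le k<n$. If $w_n\neq0$ and $S_nw_n=\lambda_nw_n$ for all large $n$, and $\lambda_n\to\lambda$, then there is an eigenfunction of $\mathcal K$ in $V$ with eigenvalue $\lambda$, and for every such eigenfunction $\phi$ there are scalars $a_n\ne0$ with $a_n\phi_{n,w_n}\to\phi$ in $L^2(A,\mu)$. Consequently, if $\kappa$ is any Markov kernel from $A$ to $\Omega$ with $d\nu(\omega,x)=\kappa(x,d\omega)\,d\mu(x)$ (for example $\kappa(x,\cdot)=P$ when $\nu=P\otimes\mu$), then for $\mu$-almost every starting point $x\in A$, 1–3 hold for $\kappa(x,\cdot)$-almost every $\omega$. -/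

import Mathlib

open MeasureTheory ProbabilityTheory Filter Topology

/-- A discrete-time random dynamical system (time `ℕ`) on the measurable space `X` over the metric
dynamical system `(Ω, P, (ψ^n))`, given by its jointly measurable one-step map `T ω : X → X`. -/
structure DiscreteRDS (Ω X : Type*) [MeasurableSpace Ω] [MeasurableSpace X] (P : Measure Ω) where
  /-- the time-one map of the driving system -/
  ψ : Ω → Ω
  /-- the one-step random map -/
  T : Ω → X → X
  measurePreserving_ψ : MeasurePreserving ψ P P
  measurable_T : Measurable fun p : Ω × X => T p.1 p.2

noncomputable section

namespace DiscreteRDS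

variable {Ω X : Type*} [MeasurableSpace Ω] [MeasurableSpace X] {P : Measure Ω}

/-- The cocycle `φ(n, ω) = T(ψ^{n-1} ω) ∘ ⋯ ∘ T(ψ ω) ∘ T(ω)`, `φ(0, ω) = id`. -/
def φ (S : DiscreteRDS Ω X P) : ℕ → Ω → X → X
  | 0, _, x => x
  | n + 1, ω, x => S.T (S.ψ^[n] ω) (S.φ n ω x)

/-- The skew product `Θ(ω, x) = (ψ ω, T(ω, x))` on `Ω × X`. -/
def skew (S : DiscreteRDS Ω X P) (p : Ω × X) : Ω × X := (S.ψ p.1, S.T p.1 p.2)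

/-- `ν` is an invariant probability measure of the RDS (invariant under the skew product, with
first marginal `P`) and the RDS is ergodic with respect to it. -/
structure IsErgodic (S : DiscreteRDS Ω X P) (ν : Measure (Ω × X)) : Prop where
  isProbabilityMeasure : IsProbabilityMeasure ν
  invariant : MeasurePreserving S.skew ν ν
  fst_eq : ν.fst = P
  ergodic_skew : Ergodic S.skew ν
  ergodic_ψ : Ergodic S.ψ P

/-- The `σ`-algebra generated by the past `φ(u, ·) x`, `u ≤ s`, of the process started at `x`. -/
abbrev past (S : DiscreteRDS Ω X P) (x : X) (s : ℕ) : MeasurableSpace Ω :=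
  ⨆ u : Fin (s + 1), MeasurableSpace.comap (fun ω => S.φ u ω x) inferInstance

/-- The processes `φ(n, ·) x`, `x ∈ X`, form a (time-homogeneous) Markov family: with the
transition function `p_t(y, B) = P (φ(t, ·) y ∈ B)`, for every starting point `x`, all times `s, t`
and all measurable `B` one has `P (φ(s + t, ·) x ∈ B | past up to s) = p_t(φ(s, ·) x, B)` a.s. -/
def IsMarkovFamily (S : DiscreteRDS Ω X P) : Prop :=
  ∀ (x : X) (s t : ℕ) (B : Set X), MeasurableSet B →
    MeasureTheory.condExp (S.past x s) P ({ω | S.φ (s + t) ω x ∈ B}.indicator fun _ => (1 : ℝ))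
      =ᵐ[P] fun ω => P.real {ω' | S.φ t ω' (S.φ s ω x) ∈ B}

/-- The stochastic Koopman operator family `𝒦^k g (x) = 𝔼 [g (φ(k, ω) x)]`. -/
def koopman (S : DiscreteRDS Ω X P) (k : ℕ) (g : X → ℂ) (x : X) : ℂ :=
  ∫ ω, g (S.φ k ω x) ∂P

/-- The expectation defining `𝒦^k g (x)` exists for `μ`-almost every `x`. -/
def KoopmanDefined (S : DiscreteRDS Ω X P) (μ : Measure X) (k : ℕ) (g : X → ℂ) : Prop :=
  ∀ᵐ x ∂μ, Integrable (fun ω => g (S.φ k ω x)) P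

/-- The stochastic Koopman operator `𝒦 = 𝒦^1` acts on the subspace `V` of `L²(X, μ)` as the linear
map `L : V → V`: for every element of `V` and every measurable representative `g` of it, `𝒦 g` is
defined almost everywhere and represents the image under `L`. -/
def IsKoopmanRestriction (S : DiscreteRDS Ω X P) (μ : Measure X)
    (V : Submodule ℂ (Lp ℂ 2 μ)) (L : V →ₗ[ℂ] V) : Prop :=
  ∀ g : X → ℂ, Measurable g → ∀ (hg : MemLp g 2 μ) (hV : hg.toLp g ∈ V),
    S.KoopmanDefined μ 1 g ∧ S.koopman 1 g =ᵐ[μ] (L ⟨hg.toLp g, hV⟩ : Lp ℂ 2 μ)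

/-- The subspace `V` of `L²(X, μ)` is invariant under the stochastic Koopman operator. -/
def KoopmanInvariant (S : DiscreteRDS Ω X P) (μ : Measure X)
    (V : Submodule ℂ (Lp ℂ 2 μ)) : Prop :=
  ∃ L : V →ₗ[ℂ] V, S.IsKoopmanRestriction μ V L

/-- The restriction of the stochastic Koopman operator to an invariant subspace. -/
def koopmanRestriction (S : DiscreteRDS Ω X P) (μ : Measure X)
    {V : Submodule ℂ (Lp ℂ 2 μ)} (h : S.KoopmanInvariant μ V) : V →ₗ[ℂ] V :=
  h.choose

theorem koopmanRestriction_spec (S : DiscreteRDS Ω X P) (μ : Measure X)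
    {V : Submodule ℂ (Lp ℂ 2 μ)} (h : S.KoopmanInvariant μ V) :
    S.IsKoopmanRestriction μ V (S.koopmanRestriction μ h) :=
  h.choose_spec

/-- The restriction is unique, so the choice above is immaterial. -/
theorem IsKoopmanRestriction.unique {S : DiscreteRDS Ω X P} {μ : Measure X}
    {V : Submodule ℂ (Lp ℂ 2 μ)} {L L' : V →ₗ[ℂ] V}
    (h : S.IsKoopmanRestriction μ V L) (h' : S.IsKoopmanRestriction μ V L') : L = L' := by
  ext1 v
  have hsm := (Lp.aestronglyMeasurable (v : Lp ℂ 2 μ))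
  obtain ⟨g, hg, hgv⟩ := hsm
  have hm : MemLp g 2 μ := (memLp_congr_ae hgv).1 (Lp.memLp _)
  have hv : hm.toLp g = v := by
    apply Lp.ext
    exact hm.coeFn_toLp.trans hgv.symm
  have hV : hm.toLp g ∈ V := hv ▸ v.2
  have hvv : (⟨hm.toLp g, hV⟩ : V) = v := Subtype.ext hv
  have e := (h g hg.measurable hm hV).2.symm.trans (h' g hg.measurable hm hV).2
  rw [hvv] at e
  exact Subtype.ext (Lp.ext e)

/-- The Krylov subspace `span {f, 𝒦 f, …, 𝒦^{m-1} f}` of `L²(X, μ)`. -/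
def krylov (S : DiscreteRDS Ω X P) (μ : Measure X) (f : X → ℂ) (m : ℕ)
    (hf : ∀ k : Fin m, MemLp (S.koopman k f) 2 μ) : Submodule ℂ (Lp ℂ 2 μ) :=
  Submodule.span ℂ (Set.range fun k : Fin m => (hf k).toLp (S.koopman k f))

instance (S : DiscreteRDS Ω X P) (μ : Measure X) (f : X → ℂ) (m : ℕ)
    (hf : ∀ k : Fin m, MemLp (S.koopman k f) 2 μ) :
    FiniteDimensional ℂ (S.krylov μ f m hf) :=
  FiniteDimensional.span_of_finite ℂ (Set.finite_range _)

/-- `u` is an eigenfunction of the stochastic Koopman operator for the eigenvalue `l`, as an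
element of the subspace `V` of `L²(X, μ)`. -/
structure IsEigenfunction (S : DiscreteRDS Ω X P) (μ : Measure X)
    (V : Submodule ℂ (Lp ℂ 2 μ)) (l : ℂ) (u : X → ℂ) : Prop where
  measurable : Measurable u
  memLp : MemLp u 2 μ
  mem : memLp.toLp u ∈ V
  ne_zero : ¬ u =ᵐ[μ] 0
  defined : S.KoopmanDefined μ 1 u
  eq : ∀ᵐ x ∂μ, S.koopman 1 u x = l * u x

/-- The stochastic Hankel matrix `H_{n × m}(ω, x)`, with entries `𝒦^j f (T^i(ω, x))`. -/
def hankel (S : DiscreteRDS Ω X P) (f : X → ℂ) (ω : Ω) (x : X) (n m : ℕ) :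
    Matrix (Fin n) (Fin m) ℂ :=
  fun i j => S.koopman j f (S.φ i ω x)

end DiscreteRDS

/-! ### The DMD algorithm -/

namespace DMD

/-- The first `r` of the `r + 1` columns of snapshots. -/
def dataX {n r : ℕ} (H : Matrix (Fin n) (Fin (r + 1)) ℂ) : Matrix (Fin n) (Fin r) ℂ :=
  H.submatrix id Fin.castSucc

/-- The last `r` of the `r + 1` columns of snapshots. -/
def dataY {n r : ℕ} (H : Matrix (Fin n) (Fin (r + 1)) ℂ) : Matrix (Fin n) (Fin r) ℂ :=
  H.submatrix id Fin.succ

/-- `A = U Σ V^*` is a singular value decomposition of the `n × r` matrix `A`, in the thin form: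
`U` is `n × r` with orthonormal columns, `V` is unitary, `Σ = diag(σ₁ ≥ ⋯ ≥ σ_r ≥ 0)`. -/
structure IsSVD {n r : ℕ} (A U : Matrix (Fin n) (Fin r) ℂ) (σ : Fin r → ℝ)
    (V : Matrix (Fin r) (Fin r) ℂ) : Prop where
  orthonormal : U.conjTranspose * U = 1
  unitary : V.conjTranspose * V = 1
  antitone : Antitone σ
  nonneg : ∀ j, 0 ≤ σ j
  eq : A = U * Matrix.diagonal (fun j => (σ j : ℂ)) * V.conjTranspose

/-- `Σ⁻¹`; meaningful when all singular values are nonzero. -/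
def invSigma {r : ℕ} (σ : Fin r → ℝ) : Matrix (Fin r) (Fin r) ℂ :=
  Matrix.diagonal fun j => ((σ j : ℂ))⁻¹

/-- The Rayleigh quotient matrix `S = U^* Y V Σ⁻¹`, whose eigenvalues are the DMD eigenvalues. -/
def rayleigh {n r : ℕ} (Y U : Matrix (Fin n) (Fin r) ℂ) (σ : Fin r → ℝ)
    (V : Matrix (Fin r) (Fin r) ℂ) : Matrix (Fin r) (Fin r) ℂ :=
  U.conjTranspose * Y * V * invSigma σ

end DMD

namespace DiscreteRDS

variable {Ω X : Type*} [MeasurableSpace Ω] [MeasurableSpace X] {P : Measure Ω}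

/-- The DMD eigenfunction belonging to an eigenvector `w` of the Rayleigh quotient matrix: the
combination of the functions `f, 𝒦 f, …, 𝒦^{r-1} f` with coefficient vector `V Σ⁻¹ w`. As
`X V Σ⁻¹ w = U w` for an SVD `X = U Σ V^*` of the data matrix, its values along the trajectory are
the entries of the Ritz vector `U w`. -/
def dmdEigenfunction (S : DiscreteRDS Ω X P) (f : X → ℂ) {r : ℕ} (σ : Fin r → ℝ)
    (V : Matrix (Fin r) (Fin r) ℂ) (w : Fin r → ℂ) (y : X) : ℂ :=
  ∑ j : Fin r, ((V * DMD.invSigma σ).mulVec w) j * S.koopman j f y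

/-- The first `r + 1` columns of the stochastic Hankel matrix `H_{n × (m + 1)}(ω, x)`. -/
def hankelCols (S : DiscreteRDS Ω X P) (f : X → ℂ) (ω : Ω) (x : X) (n : ℕ) {r m : ℕ}
    (hrm : r < m) : Matrix (Fin n) (Fin (r + 1)) ℂ :=
  (S.hankel f ω x n (m + 1)).submatrix id (Fin.castLE (Nat.succ_le_succ hrm.le))

/-- Along the trajectory of `(ω, x)`, the DMD eigenvalues and eigenfunctions computed from the
first `r + 1` columns of `H_{n × (m + 1)}(ω, x)` converge, as `n → ∞`, to the eigenvalues and
eigenfunctions of the stochastic Koopman operator on the invariant subspace `V`, on which it is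
the linear map `L`. -/
def DMDConverges (S : DiscreteRDS Ω X P) (μ : Measure X) (f : X → ℂ) {r m : ℕ} (hrm : r < m)
    (V : Submodule ℂ (Lp ℂ 2 μ)) [FiniteDimensional ℂ V] (L : V →ₗ[ℂ] V) (ω : Ω) (x : X) : Prop :=
  -- the algorithm can be run for all large `n`, with nonzero singular values
  (∀ᶠ n in atTop,
    (∃ U σ W, DMD.IsSVD (DMD.dataX (S.hankelCols f ω x n hrm)) U σ W) ∧
    ∀ U σ W, DMD.IsSVD (DMD.dataX (S.hankelCols f ω x n hrm)) U σ W → ∀ j, 0 < σ j) ∧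
  -- whatever singular value decompositions it uses
  ∀ (U : ∀ n : ℕ, Matrix (Fin n) (Fin r) ℂ) (σ : ℕ → Fin r → ℝ)
    (W : ℕ → Matrix (Fin r) (Fin r) ℂ),
    (∀ᶠ n in atTop,
      DMD.IsSVD (DMD.dataX (S.hankelCols f ω x n hrm)) (U n) (σ n) (W n)) →
    -- the DMD eigenvalues, with multiplicities, converge to the Koopman eigenvalues
    (∃ (l : Fin r → ℂ) (ln : ℕ → Fin r → ℂ),
      L.charpoly.roots = Finset.univ.val.map l ∧
      (∀ᶠ n in atTop,
        (DMD.rayleigh (DMD.dataY (S.hankelCols f ω x n hrm)) (U n) (σ n) (W n)).charpoly.roots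
          = Finset.univ.val.map (ln n)) ∧
      ∀ i, Tendsto (fun n => ln n i) atTop (𝓝 (l i))) ∧
    -- the DMD eigenfunctions take the entries of the Ritz vectors as values along the trajectory
    (∀ᶠ n in atTop, ∀ (w : Fin r → ℂ) (k : Fin n),
      S.dmdEigenfunction f (σ n) (W n) w (S.φ k ω x) = ((U n).mulVec w) k) ∧
    -- and, suitably scaled, they converge in `L²(μ)` to the Koopman eigenfunctions
    (∀ (w : ℕ → Fin r → ℂ) (ln : ℕ → ℂ) (l : ℂ),
      (∀ᶠ n in atTop, w n ≠ 0 ∧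
        (DMD.rayleigh (DMD.dataY (S.hankelCols f ω x n hrm)) (U n) (σ n) (W n)).mulVec (w n)
          = ln n • w n) →
      Tendsto ln atTop (𝓝 l) →
      (∃ u, S.IsEigenfunction μ V l u) ∧
      ∀ u, S.IsEigenfunction μ V l u →
        ∃ a : ℕ → ℂ, (∀ n, a n ≠ 0) ∧
          Tendsto (fun n => eLpNorm
            (fun y => a n * S.dmdEigenfunction f (σ n) (W n) (w n) y - u y) 2 μ) atTop (𝓝 0))

end DiscreteRDS

end

/-! The only probabilistic input is Birkhoff's theorem for the skew product. Applied to the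
functions `(ω, y) ↦ star (𝒦^i f y) * 𝒦^j f y`, which are integrable as products of two `L²`
functions, it shows that for almost every trajectory `n⁻¹ Hₙᴴ Hₙ` tends to the Gram matrix of `f, 𝒦
f, …, 𝒦^r f` (`IsErgodic.ae_tendsto_hankelCols`). The rest is linear algebra along one such
trajectory (`dmdConverges_of_tendsto`).

By the Markov property `𝒦^k f = L^k f` for `k < m`, with `L` the restriction of `𝒦` to `V`. By
Cayley–Hamilton the first `r` of these vectors form a basis (`exists_basis_krylov`), in which the
matrix of `L` is a companion matrix `C = G⁻¹ G'`, where `G` and `G'` are blocks of the Gram matrix.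
The Rayleigh quotient `Sₙ` is conjugate, through `W Σ⁻¹`, to the least squares matrix `Cₙ = (Xᴴ X)⁻¹
Xᴴ Y`, whatever the SVD (`IsSVD.mul_rayleigh`), and `Cₙ → C`.

Eigenvalues then converge because the roots of a monic polynomial depend continuously on its
coefficients. Eigenvectors converge without any simplicity assumption because `Cₙ` is itself a
companion matrix: an eigenvector is determined by its nonzero last coordinate through a recurrence
that is continuous in the eigenvalue and the matrix (`exists_tendsto_smul_eigenvector`). -/

/-! ### The pointwise ergodic theorem for ergodic maps -/

section Birkhoff

variable {α : Type*} {T : α → α} {g : α → ℝ}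

/-- The maximum of `0` and the first `n` Birkhoff sums of `g`. -/
def birkhoffMax (T : α → α) (g : α → ℝ) : ℕ → α → ℝ
  | 0, _ => 0
  | n + 1, x => max 0 (g x + birkhoffMax T g n (T x))

theorem birkhoffMax_nonneg (n : ℕ) (x : α) : 0 ≤ birkhoffMax T g n x := by
  cases n with
  | zero => exact le_rfl
  | succ n => exact le_max_left _ _

theorem birkhoffMax_le_succ (n : ℕ) : ∀ x, birkhoffMax T g n x ≤ birkhoffMax T g (n + 1) x := by
  induction n with
  | zero => exact fun x => le_max_left _ _
  | succ n ih => exact fun x => max_le_max le_rfl (add_le_add le_rfl (ih (T x)))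

theorem birkhoffSum_le_birkhoffMax (n : ℕ) : ∀ x, birkhoffSum T g n x ≤ birkhoffMax T g n x := by
  induction n with
  | zero => intro x; simp [birkhoffMax]
  | succ n ih =>
    intro x
    rw [birkhoffSum_succ']
    exact (add_le_add le_rfl (ih (T x))).trans (le_max_right _ _)

/-- The Birkhoff sums at `x` and at `T x` differ by a shift of `n` and the constant `g x`.
Boundedness is therefore an invariant event, to which ergodicity applies. -/
theorem bddAbove_range_birkhoffSum_comp_iff (x : α) :
    BddAbove (Set.range fun n => birkhoffSum T g n (T x)) ↔
      BddAbove (Set.range fun n => birkhoffSum T g n x) := by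
  simp only [bddAbove_def, Set.forall_mem_range]
  constructor
  · rintro ⟨b, hb⟩
    refine ⟨max 0 (g x + b), fun n => ?_⟩
    cases n with
    | zero => simp
    | succ n =>
      rw [birkhoffSum_succ']
      exact (add_le_add le_rfl (hb n)).trans (le_max_right _ _)
  · rintro ⟨b, hb⟩
    refine ⟨b - g x, fun n => ?_⟩
    have := hb (n + 1)
    rw [birkhoffSum_succ'] at this
    linarith

theorem tendsto_birkhoffMax {x : α} (hx : ¬ BddAbove (Set.range fun n => birkhoffSum T g n x)) :
    Tendsto (fun n => birkhoffMax T g n x) atTop atTop := by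
  refine tendsto_atTop_atTop_of_monotone
    (monotone_nat_of_le_succ fun n => birkhoffMax_le_succ n x) fun b => ?_
  by_contra! h
  exact hx ⟨b, Set.forall_mem_range.2 fun n => (birkhoffSum_le_birkhoffMax n x).trans (h n).le⟩

variable [MeasurableSpace α] {ν : Measure α}

theorem integrable_birkhoffMax (hT : MeasurePreserving T ν ν) (hg : Integrable g ν) (n : ℕ) :
    Integrable (birkhoffMax T g n) ν := by
  induction n with
  | zero => exact integrable_zero _ _ _
  | succ n ih => exact (integrable_zero _ _ _).sup (hg.add (hT.integrable_comp_of_integrable ih))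

theorem measurable_birkhoffSum (hT : Measurable T) (hg : Measurable g) (n : ℕ) :
    Measurable (birkhoffSum T g n) :=
  Finset.measurable_fun_sum _ fun k _ => hg.comp (hT.iterate k)

/-- By ergodicity the event has measure zero or one. If it were null, the maxima `Mₙ` would tend to
infinity almost everywhere, so `Mₙ₊₁ - Mₙ ∘ T = max (-Mₙ ∘ T) g` would tend to `g`. Its integral is
`∫ Mₙ₊₁ - ∫ Mₙ ≥ 0` by invariance, which would force `∫ g ≥ 0`. -/
theorem Ergodic.ae_bddAbove_birkhoffSum [IsProbabilityMeasure ν] (hT : Ergodic T ν)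
    (hgm : Measurable g) (hg : Integrable g ν) (hneg : ∫ x, g x ∂ν < 0) :
    ∀ᵐ x ∂ν, BddAbove (Set.range fun n => birkhoffSum T g n x) := by
  have hmp := hT.toMeasurePreserving
  have hA : MeasurableSet {x | BddAbove (Set.range fun n => birkhoffSum T g n x)} :=
    measurableSet_bddAbove_range fun n => measurable_birkhoffSum hmp.measurable hgm n
  have hinv : T ⁻¹' {x | BddAbove (Set.range fun n => birkhoffSum T g n x)}
      = {x | BddAbove (Set.range fun n => birkhoffSum T g n x)} := by
    ext x; exact bddAbove_range_birkhoffSum_comp_iff x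
  rcases hT.measure_self_or_compl_eq_zero hA hinv with h0 | h1
  · exfalso
    have hnb : ∀ᵐ x ∂ν, ¬ BddAbove (Set.range fun n => birkhoffSum T g n x) :=
      measure_eq_zero_iff_ae_notMem.1 h0
    -- Since `Mₙ ≥ 0`, the integrand lies between `-|g|` and `|g|`; it equals `g x` as soon as `Mₙ
    -- (T x) ≥ -g x`.
    have hlim : Tendsto (fun n => ∫ x, max (-birkhoffMax T g n (T x)) (g x) ∂ν) atTop
        (𝓝 (∫ x, g x ∂ν)) := by
      refine tendsto_integral_of_dominated_convergence (fun x => |g x|)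
        (fun n => (((hmp.integrable_comp_of_integrable
          (integrable_birkhoffMax hmp hg n)).neg).sup hg).aestronglyMeasurable) hg.abs
        (fun n => ae_of_all _ fun x => ?_) ?_
      · have := birkhoffMax_nonneg (T := T) (g := g) n (T x)
        rw [Real.norm_eq_abs]
        rcases max_cases (-birkhoffMax T g n (T x)) (g x) with h | h
        · rw [h.1, abs_of_nonpos (by linarith)]
          have := neg_abs_le (g x); linarith
        · rw [h.1]
      · filter_upwards [hnb] with x hx
        rw [← bddAbove_range_birkhoffSum_comp_iff] at hx
        refine tendsto_const_nhds.congr' ?_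
        filter_upwards [(tendsto_birkhoffMax hx).eventually_ge_atTop (-g x)] with n hn
        rw [max_eq_right (by linarith)]
    refine absurd hneg (not_lt.2 (ge_of_tendsto' hlim fun n => ?_))
    have hI := integrable_birkhoffMax hmp hg
    have e : ∀ x, max (-birkhoffMax T g n (T x)) (g x)
        = birkhoffMax T g (n + 1) x - birkhoffMax T g n (T x) := fun x => by
      simp only [birkhoffMax]
      rw [← max_sub_sub_right]; simp
    simp_rw [e]
    rw [integral_sub (g := fun x => birkhoffMax T g n (T x)) (hI (n + 1))
      (hmp.integrable_comp_of_integrable (hI n)), sub_nonneg]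
    have h2 : ∫ x, birkhoffMax T g n (T x) ∂ν = ∫ x, birkhoffMax T g n x ∂ν := by
      have := integral_map (μ := ν) hmp.measurable.aemeasurable (f := birkhoffMax T g n)
        (by rw [hmp.map_eq]; exact (hI n).aestronglyMeasurable)
      rw [← this, hmp.map_eq]
    rw [h2]
    exact integral_mono (hI n) (hI (n + 1)) (birkhoffMax_le_succ n)
  · exact mem_ae_iff.2 h1

/-- Subtracting the mean plus `ε / 2` makes the integral negative, so the shifted sums are bounded
above by some `b`; the other `ε / 2` absorbs `b / n`. -/
theorem Ergodic.ae_eventually_birkhoffSum_le [IsProbabilityMeasure ν] (hT : Ergodic T ν)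
    (hgm : Measurable g) (hg : Integrable g ν) {ε : ℝ} (hε : 0 < ε) :
    ∀ᵐ x ∂ν, ∀ᶠ n : ℕ in atTop, birkhoffSum T g n x / n ≤ ∫ x, g x ∂ν + ε := by
  set I := ∫ x, g x ∂ν with hI
  have h := hT.ae_bddAbove_birkhoffSum (g := fun x => g x - (I + ε / 2))
    (hgm.sub_const _) (hg.sub (integrable_const _)) (by
      rw [integral_sub hg (integrable_const _)]; simp [← hI, hε])
  filter_upwards [h] with x ⟨b, hb⟩
  have hlim : Tendsto (fun n : ℕ => b / (n : ℝ)) atTop (𝓝 0) :=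
    tendsto_const_div_atTop_nhds_zero_nat b
  filter_upwards [hlim.eventually_lt_const (half_pos hε), eventually_gt_atTop 0] with n hn hn0
  have h1 : birkhoffSum T (fun x => g x - (I + ε / 2)) n x ≤ b := hb ⟨n, rfl⟩
  have h2 : birkhoffSum T (fun x => g x - (I + ε / 2)) n x
      = birkhoffSum T g n x - n * (I + ε / 2) := by
    simp [birkhoffSum, mul_add]
  have hn' : (0 : ℝ) < n := Nat.cast_pos.2 hn0
  rw [div_lt_iff₀ hn'] at hn
  rw [div_le_iff₀ hn']
  linarith

/-- The one-sided bound for `-g` is the lower bound for `g`; restricting to `ε = 1 / (k + 1)` leaves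
countably many null sets. -/
theorem Ergodic.ae_tendsto_birkhoffSum_div [IsProbabilityMeasure ν] (hT : Ergodic T ν)
    (hgm : Measurable g) (hg : Integrable g ν) :
    ∀ᵐ x ∂ν, Tendsto (fun n : ℕ => birkhoffSum T g n x / n) atTop (𝓝 (∫ x, g x ∂ν)) := by
  have h1 : ∀ᵐ x ∂ν, ∀ k : ℕ, ∀ᶠ n : ℕ in atTop,
      birkhoffSum T g n x / n ≤ ∫ x, g x ∂ν + 1 / ((k : ℝ) + 1) :=
    ae_all_iff.2 fun k => hT.ae_eventually_birkhoffSum_le hgm hg Nat.one_div_pos_of_nat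
  have h2 : ∀ᵐ x ∂ν, ∀ k : ℕ, ∀ᶠ n : ℕ in atTop,
      birkhoffSum T (-g) n x / n ≤ ∫ x, (-g) x ∂ν + 1 / ((k : ℝ) + 1) :=
    ae_all_iff.2 fun k => hT.ae_eventually_birkhoffSum_le hgm.neg hg.neg Nat.one_div_pos_of_nat
  filter_upwards [h1, h2] with x hx1 hx2
  rw [Metric.tendsto_atTop']
  intro ε hε
  obtain ⟨k, hk⟩ := exists_nat_one_div_lt hε
  obtain ⟨N, hN⟩ := eventually_atTop.1 ((hx1 k).and (hx2 k))
  refine ⟨N, fun n hn => ?_⟩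
  obtain ⟨ha, hb⟩ := hN n hn.le
  have e : ∫ x, (-g) x ∂ν = - ∫ x, g x ∂ν := integral_neg g
  rw [birkhoffSum_neg, neg_div, e] at hb
  rw [Real.dist_eq, abs_lt]
  constructor <;> linarith

/-- **Birkhoff's pointwise ergodic theorem** for an ergodic map and a complex-valued function. -/
theorem Ergodic.ae_tendsto_birkhoffAverage [IsProbabilityMeasure ν] (hT : Ergodic T ν)
    {h : α → ℂ} (hm : Measurable h) (hi : Integrable h ν) :
    ∀ᵐ x ∂ν, Tendsto (fun n : ℕ => (n : ℂ)⁻¹ * birkhoffSum T h n x) atTop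
      (𝓝 (∫ x, h x ∂ν)) := by
  filter_upwards [hT.ae_tendsto_birkhoffSum_div (Complex.measurable_re.comp hm) hi.re,
    hT.ae_tendsto_birkhoffSum_div (Complex.measurable_im.comp hm) hi.im] with x hre him
  have hr := (Complex.continuous_ofReal.tendsto _).comp hre
  have hj := (Complex.continuous_ofReal.tendsto _).comp him
  have key := hr.add (hj.mul_const Complex.I)
  refine (key.congr fun n => ?_).trans (le_of_eq ?_)
  · simp only [birkhoffSum, Function.comp_apply, Complex.ofReal_div, Complex.ofReal_sum,
      Complex.ofReal_natCast]
    rw [div_mul_eq_mul_div, ← add_div, Finset.sum_mul, ← Finset.sum_add_distrib, div_eq_inv_mul]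
    simp
  · have := integral_re_add_im hi
    rw [← this]; rfl

end Birkhoff

/-! ### Continuity of the roots of a polynomial and of the characteristic polynomial -/

section Roots

open Polynomial

theorem Polynomial.Monic.card_roots_eq {p : ℂ[X]} {r : ℕ} (hd : p.natDegree = r) :
    Multiset.card p.roots = r := by
  rw [← hd]; exact (IsAlgClosed.splits p).natDegree_eq_card_roots.symm

/-- For the root `b` of `q n` closest to `a`, the product formula gives `‖a - b‖ ^ (r + 1) ≤ ‖(q
n).eval a‖`, and the right side tends to `‖p.eval a‖ = 0`. -/
theorem Polynomial.exists_root_tendsto {r : ℕ} {p : ℂ[X]} {q : ℕ → ℂ[X]}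
    (hq : ∀ n, (q n).Monic) (hqd : ∀ n, (q n).natDegree = r + 1) (hpd : p.natDegree = r + 1)
    (h : ∀ i, Tendsto (fun n => (q n).coeff i) atTop (𝓝 (p.coeff i))) {a : ℂ} (ha : p.IsRoot a) :
    ∃ b : ℕ → ℂ, (∀ n, (q n).IsRoot (b n)) ∧ Tendsto b atTop (𝓝 a) := by
  have hq0 : ∀ n, q n ≠ 0 := fun n => (hq n).ne_zero
  have hcard : ∀ n, Multiset.card (q n).roots = r + 1 :=
    fun n => Polynomial.Monic.card_roots_eq (hqd n)
  have hex : ∀ n, ∃ b, (q n).IsRoot b ∧ ‖a - b‖ ^ (r + 1) ≤ ‖(q n).eval a‖ := by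
    intro n
    have hne : (q n).roots.toFinset.Nonempty := by
      rw [Multiset.toFinset_nonempty, ← Multiset.card_pos, hcard]; omega
    obtain ⟨b, hb, hmin⟩ := Finset.exists_min_image _ (fun b => ‖a - b‖) hne
    rw [Multiset.mem_toFinset] at hb
    refine ⟨b, (mem_roots'.1 hb).2, ?_⟩
    have hprod := (IsAlgClosed.splits (q n)).eval_eq_prod_roots_of_monic (hq n) a
    rw [hprod, ← hcard n]
    have hn : ‖((q n).roots.map fun x => a - x).prod‖
        = (((q n).roots.map fun x => a - x).map fun z => ‖z‖).prod :=
      map_multiset_prod (normHom : ℂ →*₀ ℝ) _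
    rw [hn, Multiset.map_map, ← Multiset.prod_replicate, ← Multiset.map_const']
    exact Multiset.prod_map_le_prod_map₀ _ _ (fun _ _ => norm_nonneg _)
      fun c hc => hmin c (Multiset.mem_toFinset.2 hc)
  choose b hb hle using hex
  refine ⟨b, hb, ?_⟩
  have hev : Tendsto (fun n => (q n).eval a) atTop (𝓝 0) := by
    have e : ∀ n, (q n).eval a = ∑ i ∈ Finset.range (r + 2), (q n).coeff i * a ^ i := fun n => by
      rw [eval_eq_sum_range, hqd]
    have e' : (0 : ℂ) = ∑ i ∈ Finset.range (r + 2), p.coeff i * a ^ i := by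
      have := eval_eq_sum_range (p := p) a
      rw [hpd] at this
      rw [← this]; exact ha.symm
    simp_rw [e]
    rw [e']
    exact tendsto_finsetSum _ fun i _ => (h i).mul_const _
  have hpow : Tendsto (fun n => ‖a - b n‖ ^ (r + 1)) atTop (𝓝 0) :=
    squeeze_zero (fun n => by positivity) hle (by simpa using hev.norm)
  have hroot := hpow.rpow_const (p := (((r + 1 : ℕ) : ℝ))⁻¹) (Or.inr (by positivity))
  have h0 : Tendsto (fun n => ‖a - b n‖) atTop (𝓝 0) := by
    refine (hroot.congr fun n => Real.pow_rpow_inv_natCast (norm_nonneg _) (by omega)).trans ?_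
    rw [Real.zero_rpow (by positivity)]
  rw [tendsto_iff_norm_sub_tendsto_zero]
  exact h0.congr fun n => norm_sub_rev _ _

/-- If the coefficients of monic polynomials of degree `r` converge, then so do their roots,
suitably enumerated. -/
theorem Polynomial.exists_roots_tendsto {r : ℕ} : ∀ {p : ℂ[X]} {q : ℕ → ℂ[X]}
    (_ : p.Monic) (_ : ∀ n, (q n).Monic) (_ : ∀ n, (q n).natDegree = r) (_ : p.natDegree = r)
    (_ : ∀ i, Tendsto (fun n => (q n).coeff i) atTop (𝓝 (p.coeff i))),
    ∃ (l : Fin r → ℂ) (ln : ℕ → Fin r → ℂ), p.roots = Finset.univ.val.map l ∧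
      (∀ n, (q n).roots = Finset.univ.val.map (ln n)) ∧
      ∀ i, Tendsto (fun n => ln n i) atTop (𝓝 (l i)) := by
  induction r with
  | zero =>
    intro p q hp hq hqd hpd h
    refine ⟨Fin.elim0, fun _ => Fin.elim0, ?_, fun n => ?_, fun i => i.elim0⟩
    · simpa using Multiset.card_eq_zero.1 (Polynomial.Monic.card_roots_eq hpd)
    · simpa using Multiset.card_eq_zero.1 (Polynomial.Monic.card_roots_eq (hqd n))
  | succ r ih =>
    intro p q hp hq hqd hpd h
    obtain ⟨a, ha⟩ := IsAlgClosed.exists_root p (by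
      rw [degree_eq_natDegree hp.ne_zero, hpd]; exact_mod_cast Nat.succ_ne_zero r)
    obtain ⟨b, hb, hba⟩ := exists_root_tendsto hq hqd hpd h ha
    have hroots : ∀ (s : ℂ[X]) (c : ℂ), s ≠ 0 → s.IsRoot c →
        s.roots = c ::ₘ (s /ₘ (X - C c)).roots := by
      intro s c hs hc
      have e := mul_divByMonic_eq_iff_isRoot.2 hc
      conv_lhs => rw [← e]
      rw [roots_mul (by rw [e]; exact hs), roots_X_sub_C, Multiset.singleton_add]
    have hmon : ∀ (s : ℂ[X]) (c : ℂ), s.Monic → s.IsRoot c → (s /ₘ (X - C c)).Monic := by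
      intro s c hs hc
      have e := mul_divByMonic_eq_iff_isRoot.2 hc
      exact (monic_X_sub_C c).of_mul_monic_left (by rw [e]; exact hs)
    have hdeg : ∀ (s : ℂ[X]) (c : ℂ), s.natDegree = r + 1 →
        (s /ₘ (X - C c)).natDegree = r := by
      intro s c hs
      rw [natDegree_divByMonic _ (monic_X_sub_C c), hs, natDegree_X_sub_C]; rfl
    -- Induct on the quotients by `X - C a` and `X - C (b n)`: their coefficients are polynomial
    -- expressions in the root and the old coefficients, hence still converge.
    obtain ⟨l, ln, hl, hln, ht⟩ := ih (hmon p a hp ha) (fun n => hmon _ _ (hq n) (hb n))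
      (fun n => hdeg _ _ (hqd n)) (hdeg _ _ hpd) (fun i => by
        simp_rw [coeff_divByMonic_X_sub_C, hqd, hpd]
        exact tendsto_finsetSum _ fun j _ => (hba.pow _).mul (h j))
    refine ⟨Fin.cons a l, fun n => Fin.cons (b n) (ln n), ?_, fun n => ?_, fun i => ?_⟩
    · rw [hroots p a hp.ne_zero ha, hl]
      simp [Fin.univ_succ, Function.comp_def]
    · rw [hroots _ _ (hq n).ne_zero (hb n), hln]
      simp [Fin.univ_succ, Function.comp_def]
    · refine Fin.cases ?_ (fun i => ?_) i
      · simpa using hba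
      · simpa using ht i

/-- Each coefficient is a universal polynomial in the matrix entries. -/
theorem Matrix.continuous_charpoly_coeff {ι : Type*} [Fintype ι] [DecidableEq ι] (i : ℕ) :
    Continuous fun M : Matrix ι ι ℂ => M.charpoly.coeff i := by
  have e : ∀ M : Matrix ι ι ℂ, M.charpoly.coeff i
      = MvPolynomial.eval (fun q : ι × ι => M q.1 q.2) ((Matrix.charpoly.univ ℂ ι).coeff i) := by
    intro M
    exact (Matrix.charpoly.univ_coeff_eval₂Hom ι (RingHom.id ℂ) (fun q => M q.1 q.2) i).symm
  simp_rw [e]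
  exact (MvPolynomial.continuous_eval _).comp (by fun_prop)

end Roots

/-! ### Companion matrices -/

namespace DMD

open Matrix

variable {r : ℕ}

/-- The columns of `M` except the last are those of a companion matrix. -/
def IsCompanion (M : Matrix (Fin r) (Fin r) ℂ) : Prop :=
  ∀ (j : Fin r) (h : j.1 + 1 < r) (i : Fin r), M i j = if i = ⟨j.1 + 1, h⟩ then 1 else 0

theorem IsCompanion.mulVec_succ {M : Matrix (Fin (r + 1)) (Fin (r + 1)) ℂ} (hM : IsCompanion M)
    (c : Fin (r + 1) → ℂ) (i : Fin r) :
    (M *ᵥ c) i.succ = c i.castSucc + M i.succ (Fin.last r) * c (Fin.last r) := by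
  rw [mulVec, dotProduct, Fin.sum_univ_castSucc]
  congr 1
  rw [Finset.sum_eq_single i]
  · rw [hM i.castSucc (by simp) i.succ]
    simp [Fin.ext_iff]
  · intro j _ hj
    rw [hM j.castSucc (by simp) i.succ, if_neg, zero_mul]
    simpa [Fin.ext_iff, eq_comm] using hj
  · simp

/-- Row `i + 1` of the eigenvalue equation involves only the coordinates `i`, `i + 1` and the last
one. Read backwards, it recovers the whole eigenvector from its last coordinate. -/
theorem IsCompanion.eigenvector_castSucc {M : Matrix (Fin (r + 1)) (Fin (r + 1)) ℂ}
    (hM : IsCompanion M) {c : Fin (r + 1) → ℂ} {l : ℂ} (h : M *ᵥ c = l • c) (i : Fin r) :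
    c i.castSucc = l * c i.succ - M i.succ (Fin.last r) * c (Fin.last r) := by
  have := congrFun h i.succ
  rw [hM.mulVec_succ] at this
  rw [eq_sub_iff_add_eq, this]; rfl

theorem IsCompanion.eigenvector_last_ne_zero {M : Matrix (Fin (r + 1)) (Fin (r + 1)) ℂ}
    (hM : IsCompanion M) {c : Fin (r + 1) → ℂ} {l : ℂ} (h : M *ᵥ c = l • c) (hc : c ≠ 0) :
    c (Fin.last r) ≠ 0 := by
  intro h0
  refine hc (funext fun i => ?_)
  induction i using Fin.reverseInduction with
  | last => exact h0
  | cast i ih => rw [hM.eigenvector_castSucc h i, ih, h0]; simp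

/-- Eigenvectors of convergent companion matrices converge, suitably scaled, to any eigenvector
of the limit. -/
theorem exists_tendsto_smul_eigenvector {Mn : ℕ → Matrix (Fin r) (Fin r) ℂ}
    {M : Matrix (Fin r) (Fin r) ℂ} (hMn : ∀ᶠ n in atTop, IsCompanion (Mn n)) (hM : IsCompanion M)
    (ht : Tendsto Mn atTop (𝓝 M)) {cn : ℕ → Fin r → ℂ} {ln : ℕ → ℂ} {c : Fin r → ℂ} {l : ℂ}
    (hn : ∀ᶠ n in atTop, cn n ≠ 0 ∧ Mn n *ᵥ cn n = ln n • cn n) (hl : Tendsto ln atTop (𝓝 l))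
    (hc : c ≠ 0) (h : M *ᵥ c = l • c) :
    ∃ a : ℕ → ℂ, (∀ n, a n ≠ 0) ∧ Tendsto (fun n => a n • cn n) atTop (𝓝 c) := by
  cases r with
  | zero => exact absurd (Subsingleton.elim c 0) hc
  | succ r =>
  have hcl := hM.eigenvector_last_ne_zero h hc
  -- The scaling matches the last coordinate of `cn n` with that of `c`. The value `1` is only a
  -- filler: for large `n` the last coordinate is nonzero.
  refine ⟨fun n => if cn n (Fin.last r) = 0 then 1 else c (Fin.last r) / cn n (Fin.last r),
    fun n => ?_, ?_⟩
  · dsimp only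
    split_ifs with h0
    · exact one_ne_zero
    · exact div_ne_zero hcl h0
  set a : ℕ → ℂ :=
    fun n => if cn n (Fin.last r) = 0 then 1 else c (Fin.last r) / cn n (Fin.last r) with ha
  have hlast : ∀ᶠ n in atTop, a n * cn n (Fin.last r) = c (Fin.last r) := by
    filter_upwards [hMn, hn] with n hn1 hn2
    have h0 := hn1.eigenvector_last_ne_zero hn2.2 hn2.1
    simp only [ha, if_neg h0]
    exact div_mul_cancel₀ _ h0
  rw [tendsto_pi_nhds]
  intro i
  induction i using Fin.reverseInduction with
  | last => exact tendsto_const_nhds.congr' (hlast.mono fun n hn => hn.symm)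
  | cast i ih =>
    -- The scaled vectors and `c` obey the same backward recurrence, with convergent coefficients.
    rw [hM.eigenvector_castSucc h i]
    have hMi := tendsto_pi_nhds.1 (tendsto_pi_nhds.1 ht i.succ) (Fin.last r)
    refine ((hl.mul ih).sub (hMi.mul_const _)).congr' ?_
    filter_upwards [hMn, hn, hlast] with n hn1 hn2 hn3
    simp only [Pi.smul_apply, smul_eq_mul]
    rw [hn1.eigenvector_castSucc hn2.2 i, ← hn3]
    ring

/-! ### The singular value decomposition and the Rayleigh quotient -/

section SVD

variable {n : ℕ} {A U : Matrix (Fin n) (Fin r) ℂ} {σ : Fin r → ℝ} {W : Matrix (Fin r) (Fin r) ℂ}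

theorem IsSVD.mul_eq (h : IsSVD A U σ W) :
    A * W = U * diagonal fun j => (σ j : ℂ) := by
  rw [h.eq, Matrix.mul_assoc, h.unitary, Matrix.mul_one]

theorem IsSVD.conjTranspose_mul_self (h : IsSVD A U σ W) :
    Aᴴ * A = W * diagonal (fun j => (σ j : ℂ) * σ j) * Wᴴ := by
  have hd : (diagonal fun j => (σ j : ℂ))ᴴ = diagonal fun j => (σ j : ℂ) := by
    rw [diagonal_conjTranspose]; congr 1; ext j; simp
  conv_lhs => rw [h.eq]
  simp only [conjTranspose_mul, conjTranspose_conjTranspose, hd]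
  calc _ = W * (diagonal fun j => (σ j : ℂ)) * (Uᴴ * U) * (diagonal fun j => (σ j : ℂ)) * Wᴴ := by
        simp only [Matrix.mul_assoc]
    _ = _ := by
        rw [h.orthonormal, Matrix.mul_one, Matrix.mul_assoc W, diagonal_mul_diagonal]

theorem IsSVD.pos (h : IsSVD A U σ W) (hdet : (Aᴴ * A).det ≠ 0) (j : Fin r) : 0 < σ j := by
  refine lt_of_le_of_ne (h.nonneg j) fun h0 => hdet ?_
  rw [h.conjTranspose_mul_self, det_mul, det_mul, det_diagonal,
    Finset.prod_eq_zero (Finset.mem_univ j) (by simp [← h0]), mul_zero, zero_mul]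

theorem diagonal_mul_invSigma (hσ : ∀ j, 0 < σ j) :
    (diagonal fun j => (σ j : ℂ)) * invSigma σ = 1 := by
  rw [invSigma, diagonal_mul_diagonal, ← diagonal_one]
  congr 1; ext j
  exact mul_inv_cancel₀ (by exact_mod_cast (hσ j).ne')

theorem IsSVD.mul_mul_invSigma (h : IsSVD A U σ W) (hσ : ∀ j, 0 < σ j) :
    A * (W * invSigma σ) = U := by
  rw [← Matrix.mul_assoc, h.mul_eq, Matrix.mul_assoc, diagonal_mul_invSigma hσ, Matrix.mul_one]

theorem IsSVD.left_inv (h : IsSVD A U σ W) (hσ : ∀ j, 0 < σ j) :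
    ((diagonal fun j => (σ j : ℂ)) * Wᴴ) * (W * invSigma σ) = 1 := by
  rw [Matrix.mul_assoc, ← Matrix.mul_assoc Wᴴ, h.unitary, Matrix.one_mul,
    diagonal_mul_invSigma hσ]

/-- The Rayleigh quotient is similar to the least squares companion matrix. -/
theorem IsSVD.mul_rayleigh (h : IsSVD A U σ W) (hdet : (Aᴴ * A).det ≠ 0)
    (Y : Matrix (Fin n) (Fin r) ℂ) :
    (W * invSigma σ) * rayleigh Y U σ W = ((Aᴴ * A)⁻¹ * (Aᴴ * Y)) * (W * invSigma σ) := by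
  have hσ := h.pos hdet
  have hu : IsUnit (Aᴴ * A).det := isUnit_iff_ne_zero.2 hdet
  -- As `A W Σ⁻¹ = U`, this says `Aᴴ U Uᴴ = Aᴴ`: the projection `U Uᴴ` fixes the columns of `A`.
  -- Consequently `W Σ⁻¹ Uᴴ` is the pseudoinverse `(Aᴴ A)⁻¹ Aᴴ`.
  have key : (Aᴴ * A) * (W * invSigma σ) * Uᴴ = Aᴴ := by
    rw [Matrix.mul_assoc Aᴴ, h.mul_mul_invSigma hσ]
    have hd : (diagonal fun j => (σ j : ℂ))ᴴ = diagonal fun j => (σ j : ℂ) := by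
      rw [diagonal_conjTranspose]; congr 1; ext j; simp
    rw [h.eq]
    simp only [conjTranspose_mul, conjTranspose_conjTranspose, hd]
    rw [Matrix.mul_assoc W, Matrix.mul_assoc W, Matrix.mul_assoc _ Uᴴ U, h.orthonormal,
      Matrix.mul_one]
  have key' : (W * invSigma σ) * Uᴴ = (Aᴴ * A)⁻¹ * Aᴴ := by
    rw [← nonsing_inv_mul_cancel_left (Aᴴ * A) (W * invSigma σ * Uᴴ) hu, ← Matrix.mul_assoc (Aᴴ * A),
      key]
  rw [rayleigh, ← Matrix.mul_assoc (Aᴴ * A)⁻¹, ← key']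
  simp only [Matrix.mul_assoc]

theorem IsSVD.charpoly_rayleigh (h : IsSVD A U σ W) (hdet : (Aᴴ * A).det ≠ 0)
    (Y : Matrix (Fin n) (Fin r) ℂ) :
    (rayleigh Y U σ W).charpoly = ((Aᴴ * A)⁻¹ * (Aᴴ * Y)).charpoly := by
  have h1 := h.left_inv (h.pos hdet)
  have e : rayleigh Y U σ W = ((diagonal fun j => (σ j : ℂ)) * Wᴴ) *
      (((Aᴴ * A)⁻¹ * (Aᴴ * Y)) * (W * invSigma σ)) := by
    rw [← h.mul_rayleigh hdet, ← Matrix.mul_assoc, h1, Matrix.one_mul]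
  rw [e, charpoly_mul_comm, Matrix.mul_assoc, mul_eq_one_comm.1 h1, Matrix.mul_one]

/-- Conjugation by `W Σ⁻¹` turns an eigenvector `w` into the coefficient vector of the DMD
eigenfunction, which is thus an eigenvector of the least squares matrix. -/
theorem IsSVD.eigenvector (h : IsSVD A U σ W) (hdet : (Aᴴ * A).det ≠ 0)
    (Y : Matrix (Fin n) (Fin r) ℂ) {w : Fin r → ℂ} {l : ℂ} (hw : w ≠ 0)
    (he : rayleigh Y U σ W *ᵥ w = l • w) :
    (W * invSigma σ) *ᵥ w ≠ 0 ∧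
      ((Aᴴ * A)⁻¹ * (Aᴴ * Y)) *ᵥ ((W * invSigma σ) *ᵥ w) = l • ((W * invSigma σ) *ᵥ w) := by
  constructor
  · intro h0
    apply hw
    rw [← Matrix.one_mulVec w, ← h.left_inv (h.pos hdet), ← mulVec_mulVec, h0, mulVec_zero]
  · rw [mulVec_mulVec, ← h.mul_rayleigh hdet, ← mulVec_mulVec, he, mulVec_smul]

open scoped ComplexOrder in
/-- A matrix of full column rank has a singular value decomposition. -/
theorem exists_isSVD (A : Matrix (Fin n) (Fin r) ℂ) (hdet : (Aᴴ * A).det ≠ 0) :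
    ∃ U σ W, IsSVD A U σ W := by
  have hpsd : (Aᴴ * A).PosSemidef := posSemidef_conjTranspose_mul_self A
  have hpd : (Aᴴ * A).PosDef := hpsd.posDef_iff_det_ne_zero.2 hdet
  set hH := hpd.isHermitian
  -- Sorting the negated eigenvalues increasingly puts the singular values in nonincreasing order.
  set τ := Tuple.sort fun j => - hH.eigenvalues j with hτ
  have hmono : Monotone ((fun j => - hH.eigenvalues j) ∘ τ) := Tuple.monotone_sort _
  set W₀ : Matrix (Fin r) (Fin r) ℂ := hH.eigenvectorUnitary.1 with hW₀
  have hW₀u : W₀ᴴ * W₀ = 1 := Unitary.coe_star_mul_self hH.eigenvectorUnitary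
  have hspec : W₀ᴴ * (Aᴴ * A) * W₀ = diagonal fun j => (hH.eigenvalues j : ℂ) := by
    have := hH.conjStarAlgAut_star_eigenvectorUnitary
    rw [Unitary.conjStarAlgAut_apply] at this
    rw [Unitary.coe_star, star_star] at this
    exact this
  set W := W₀.submatrix id τ with hW
  have hWu : Wᴴ * W = 1 := by
    rw [hW, conjTranspose_submatrix, ← submatrix_mul _ _ _ id _ Function.bijective_id, hW₀u]
    exact submatrix_one_equiv τ
  set σ : Fin r → ℝ := fun j => Real.sqrt (hH.eigenvalues (τ j)) with hσ
  have hσpos : ∀ j, 0 < σ j := fun j => Real.sqrt_pos.2 (hpd.eigenvalues_pos _)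
  have hWspec : Wᴴ * (Aᴴ * A) * W = diagonal fun j => (σ j : ℂ) * σ j := by
    have e : Wᴴ * (Aᴴ * A) * W = (W₀ᴴ * (Aᴴ * A) * W₀).submatrix τ τ := by
      rw [submatrix_mul _ _ _ id _ Function.bijective_id,
        submatrix_mul _ _ _ id _ Function.bijective_id]
      rfl
    rw [e, hspec, submatrix_diagonal_equiv]
    congr 1; ext j
    simp only [Function.comp_apply, hσ]
    rw [← Complex.ofReal_mul, Real.mul_self_sqrt (hpd.eigenvalues_pos _).le]
  have hdi := diagonal_mul_invSigma hσpos
  have hid : invSigma σ * (diagonal fun j => (σ j : ℂ)) = 1 := mul_eq_one_comm.1 hdi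
  have hih : (invSigma σ)ᴴ = invSigma σ := by
    rw [invSigma, diagonal_conjTranspose]; congr 1; ext j; simp
  refine ⟨A * (W * invSigma σ), σ, W, ?_, hWu, ?_, fun j => (hσpos j).le, ?_⟩
  · calc (A * (W * invSigma σ))ᴴ * (A * (W * invSigma σ))
        = invSigma σ * (Wᴴ * (Aᴴ * A) * W) * invSigma σ := by
          simp only [conjTranspose_mul, hih, Matrix.mul_assoc]
      _ = (invSigma σ * diagonal fun j => (σ j : ℂ)) *
            ((diagonal fun j => (σ j : ℂ)) * invSigma σ) := by
          rw [hWspec, ← diagonal_mul_diagonal]; simp only [Matrix.mul_assoc]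
      _ = 1 := by rw [hid, hdi, Matrix.one_mul]
  · intro i j hij
    exact Real.sqrt_le_sqrt (neg_le_neg_iff.1 (hmono hij))
  · rw [Matrix.mul_assoc A, Matrix.mul_assoc W, hid, Matrix.mul_one, Matrix.mul_assoc,
      mul_eq_one_comm.1 hWu, Matrix.mul_one]

end SVD

/-- The least squares matrix of shifted data is a companion matrix. -/
theorem isCompanion_of_shift (G : Matrix (Fin r) (Fin r) ℂ)
    (hG : G.det ≠ 0) (G' : Matrix (Fin r) (Fin r) ℂ)
    (h : ∀ (j : Fin r) (hj : j.1 + 1 < r) (i : Fin r), G' i j = G i ⟨j.1 + 1, hj⟩) :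
    IsCompanion (G⁻¹ * G') := by
  intro j hj i
  have hu : IsUnit G.det := isUnit_iff_ne_zero.2 hG
  -- Column `j` of `G'` is column `j + 1` of `G`, which `G⁻¹` sends to a standard basis vector.
  have : (G⁻¹ * G') i j = (G⁻¹ * G) i ⟨j.1 + 1, hj⟩ := by
    simp only [mul_apply, h j hj]
  rw [this, nonsing_inv_mul _ hu, one_apply]

theorem dataX_conjTranspose_mul_dataX {n : ℕ} (H : Matrix (Fin n) (Fin (r + 1)) ℂ) :
    (dataX H)ᴴ * dataX H = (Hᴴ * H).submatrix Fin.castSucc Fin.castSucc := rfl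

theorem tendsto_inv_of_det_ne_zero {ι : Type*} {F : Filter ι}
    {M : ι → Matrix (Fin r) (Fin r) ℂ} {N : Matrix (Fin r) (Fin r) ℂ} (h : Tendsto M F (𝓝 N))
    (hN : N.det ≠ 0) : Tendsto (fun i => (M i)⁻¹) F (𝓝 N⁻¹) := by
  simp only [inv_def, Ring.inverse_eq_inv']
  have hd : Tendsto (fun i => (M i).det) F (𝓝 N.det) :=
    ((continuous_id.matrix_det).tendsto N).comp h
  have ha : Tendsto (fun i => (M i).adjugate) F (𝓝 N.adjugate) :=
    ((continuous_id.matrix_adjugate).tendsto N).comp h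
  exact (hd.inv₀ hN).smul ha

/-! ### Passage to the limit in the normal equations -/

section Limit

variable {H : ∀ n : ℕ, Matrix (Fin n) (Fin (r + 1)) ℂ} {g : Matrix (Fin (r + 1)) (Fin (r + 1)) ℂ}

theorem eventually_det_ne_zero
    (h : Tendsto (fun n : ℕ => (n : ℂ)⁻¹ • ((H n)ᴴ * H n)) atTop (𝓝 g))
    (hdet : (g.submatrix (Fin.castSucc : Fin r → _) Fin.castSucc).det ≠ 0) :
    ∀ᶠ n in atTop, ((dataX (H n))ᴴ * dataX (H n)).det ≠ 0 := by
  have h1 := ((continuous_id.matrix_submatrix (Fin.castSucc : Fin r → _)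
    (Fin.castSucc : Fin r → _)).matrix_det.tendsto g).comp h
  filter_upwards [h1.eventually_ne hdet] with n hn h0
  apply hn
  simp only [Function.comp_apply, id, submatrix_smul, Pi.smul_apply, det_smul]
  rw [← dataX_conjTranspose_mul_dataX, h0, mul_zero]

/-- The factors `n⁻¹` in `Xᴴ X` and in `Xᴴ Y` cancel, so the least squares matrix is a continuous
function of `n⁻¹ Hᴴ H` near the invertible limit block. -/
theorem tendsto_leastSquares
    (h : Tendsto (fun n : ℕ => (n : ℂ)⁻¹ • ((H n)ᴴ * H n)) atTop (𝓝 g))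
    (hdet : (g.submatrix (Fin.castSucc : Fin r → _) Fin.castSucc).det ≠ 0) :
    Tendsto (fun n => ((dataX (H n))ᴴ * dataX (H n))⁻¹ * ((dataX (H n))ᴴ * dataY (H n))) atTop
      (𝓝 ((g.submatrix Fin.castSucc Fin.castSucc)⁻¹ * g.submatrix Fin.castSucc Fin.succ)) := by
  have h1 := ((continuous_id.matrix_submatrix (Fin.castSucc : Fin r → _)
    (Fin.castSucc : Fin r → _)).tendsto g).comp h
  have h2 := ((continuous_id.matrix_submatrix (Fin.castSucc : Fin r → _)
    (Fin.succ : Fin r → _)).tendsto g).comp h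
  refine ((tendsto_inv_of_det_ne_zero h1 hdet).mul h2).congr' ?_
  filter_upwards [eventually_gt_atTop 0, eventually_det_ne_zero h hdet] with n hn hd
  have hn' : (n : ℂ)⁻¹ ≠ 0 := inv_ne_zero (Nat.cast_ne_zero.2 hn.ne')
  let := invertibleOfNonzero hn'
  rw [dataX_conjTranspose_mul_dataX] at hd
  simp only [Function.comp_apply, id, submatrix_smul, Pi.smul_apply]
  rw [inv_smul _ _ (isUnit_iff_ne_zero.2 hd), smul_mul_smul_comm, invOf_mul_self, one_smul]
  rfl

end Limit

end DMD

/-! ### The stochastic Koopman operators -/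

namespace DiscreteRDS

variable {Ω X : Type*} [MeasurableSpace Ω] [MeasurableSpace X] {P : Measure Ω}

theorem measurable_φ (S : DiscreteRDS Ω X P) (n : ℕ) :
    Measurable fun p : Ω × X => S.φ n p.1 p.2 := by
  induction n with
  | zero => exact measurable_snd
  | succ n ih =>
    exact S.measurable_T.comp
      (((S.measurePreserving_ψ.measurable.iterate n).comp measurable_fst).prodMk ih)

theorem measurable_φ_left (S : DiscreteRDS Ω X P) (n : ℕ) (x : X) :
    Measurable fun ω => S.φ n ω x :=
  (S.measurable_φ n).comp measurable_prodMk_right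

theorem skew_iterate (S : DiscreteRDS Ω X P) (n : ℕ) (p : Ω × X) :
    S.skew^[n] p = (S.ψ^[n] p.1, S.φ n p.1 p.2) := by
  induction n with
  | zero => rfl
  | succ n ih => rw [Function.iterate_succ_apply', ih, Function.iterate_succ_apply']; rfl

theorem measurable_koopman [SFinite P] (S : DiscreteRDS Ω X P) (k : ℕ) {g : X → ℂ}
    (hg : Measurable g) : Measurable (S.koopman k g) :=
  (StronglyMeasurable.integral_prod_left (f := fun ω x => g (S.φ k ω x))
    (hg.comp (S.measurable_φ k)).stronglyMeasurable).measurable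

/-- The transition kernel `p_t(x, ·)`, the distribution of `φ(t, ·) x`. -/
noncomputable def transition [SFinite P] (S : DiscreteRDS Ω X P) (t : ℕ) : Kernel X X where
  toFun x := P.map fun ω => S.φ t ω x
  measurable' := by
    refine Measure.measurable_of_measurable_coe _ fun B hB => ?_
    simp_rw [Measure.map_apply (S.measurable_φ_left t _) hB]
    exact measurable_measure_prodMk_right (S.measurable_φ t hB)

theorem transition_apply [SFinite P] (S : DiscreteRDS Ω X P) (t : ℕ) (x : X) :
    S.transition t x = P.map fun ω => S.φ t ω x := rfl

instance [IsProbabilityMeasure P] (S : DiscreteRDS Ω X P) (t : ℕ) :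
    IsMarkovKernel (S.transition t) :=
  ⟨fun x => Measure.isProbabilityMeasure_map (S.measurable_φ_left t x).aemeasurable⟩

theorem past_le (S : DiscreteRDS Ω X P) (x : X) (s : ℕ) :
    S.past x s ≤ (inferInstance : MeasurableSpace Ω) :=
  iSup_le fun u => (S.measurable_φ_left u x).comap_le

/-- The Chapman–Kolmogorov equation. -/
theorem IsMarkovFamily.bind_transition [IsProbabilityMeasure P] {S : DiscreteRDS Ω X P}
    (h : S.IsMarkovFamily) (s t : ℕ) (x : X) :
    (S.transition s x).bind (S.transition t) = S.transition (s + t) x := by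
  ext B hB
  have hm : Measurable fun y => S.transition t y B := (S.transition t).measurable_coe hB
  rw [Measure.bind_apply hB (S.transition t).measurable.aemeasurable, transition_apply,
    lintegral_map hm (S.measurable_φ_left s x), transition_apply,
    Measure.map_apply (S.measurable_φ_left _ x) hB]
  have hset : MeasurableSet {ω | S.φ (s + t) ω x ∈ B} := S.measurable_φ_left _ x hB
  have e : ∀ y, (S.transition t y).real B = P.real {ω | S.φ t ω y ∈ B} := fun y => by
    rw [transition_apply, map_measureReal_apply (S.measurable_φ_left t y) hB]; rfl
  -- Only the expectation of the Markov property is needed: integrating the conditional probability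
  -- removes the conditioning on the past.
  have h1 := integral_condExp (μ := P) (f := {ω | S.φ (s + t) ω x ∈ B}.indicator fun _ => (1 : ℝ))
    (S.past_le x s)
  rw [integral_congr_ae (h x s t B hB), integral_indicator_const _ hset, smul_eq_mul, mul_one] at h1
  simp_rw [← e] at h1
  have hint : Integrable (fun ω => (S.transition t (S.φ s ω x)).real B) P := by
    refine Integrable.of_bound
      (hm.comp (S.measurable_φ_left s x)).ennreal_toReal.aestronglyMeasurable 1
      (ae_of_all _ fun ω => ?_)
    rw [Real.norm_of_nonneg measureReal_nonneg]
    exact measureReal_le_one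
  have h2 := ofReal_integral_eq_lintegral_ofReal hint (ae_of_all _ fun _ => measureReal_nonneg)
  rw [h1] at h2
  rw [ofReal_measureReal] at h2
  refine Eq.trans ?_ h2.symm
  exact lintegral_congr fun ω => (ofReal_measureReal (measure_ne_top _ _)).symm

/-- The semigroup property of the stochastic Koopman operators, at a point where the expectation
exists. -/
theorem IsMarkovFamily.koopman_koopman [IsProbabilityMeasure P] {S : DiscreteRDS Ω X P}
    (h : S.IsMarkovFamily) (s t : ℕ) {g : X → ℂ} (hg : Measurable g) {x : X}
    (hi : Integrable (fun ω => g (S.φ (s + t) ω x)) P) :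
    S.koopman s (S.koopman t g) x = S.koopman (s + t) g x := by
  have hk : ∀ k y, S.koopman k g y = ∫ z, g z ∂(S.transition k y) := fun k y => by
    rw [transition_apply, integral_map (S.measurable_φ_left k y).aemeasurable
      hg.aestronglyMeasurable]; rfl
  -- By Chapman–Kolmogorov the composed kernel is the law at time `s + t`, so existence of the one
  -- expectation in `hi` justifies Fubini for the composition.
  have hi' : Integrable g ((S.transition s x).bind (S.transition t)) := by
    rw [h.bind_transition, transition_apply]
    exact (integrable_map_measure hg.aestronglyMeasurable
      (S.measurable_φ_left _ x).aemeasurable).2 hi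
  rw [← Kernel.comp_apply] at hi'
  rw [hk (s + t), ← h.bind_transition, ← Kernel.comp_apply, Kernel.integral_comp hi']
  simp_rw [← hk]
  rw [transition_apply, integral_map (S.measurable_φ_left s x).aemeasurable
    (S.measurable_koopman t hg).aestronglyMeasurable]
  rfl

/-- Every eigenvector of the restricted Koopman operator is represented by an eigenfunction. -/
theorem IsKoopmanRestriction.exists_isEigenfunction {S : DiscreteRDS Ω X P} {μ : Measure X}
    {V : Submodule ℂ (Lp ℂ 2 μ)} {L : V →ₗ[ℂ] V} (hL : S.IsKoopmanRestriction μ V L) {l : ℂ}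
    {v : V} (hv : v ≠ 0) (h : L v = l • v) : ∃ u, S.IsEigenfunction μ V l u := by
  obtain ⟨g, hg, hgv⟩ := Lp.aestronglyMeasurable (v : Lp ℂ 2 μ)
  have hm : MemLp g 2 μ := (memLp_congr_ae hgv).1 (Lp.memLp _)
  have hgl : hm.toLp g = v := Lp.ext (hm.coeFn_toLp.trans hgv.symm)
  have hV : hm.toLp g ∈ V := hgl ▸ v.2
  have hvv : (⟨hm.toLp g, hV⟩ : V) = v := Subtype.ext hgl
  obtain ⟨hd, he⟩ := hL g hg.measurable hm hV
  rw [hvv, h] at he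
  refine ⟨g, hg.measurable, hm, hV, fun h0 => hv (Subtype.ext (Lp.ext ?_)), hd, ?_⟩
  · exact (hgv.trans h0).trans (Lp.coeFn_zero ℂ 2 μ).symm
  · filter_upwards [he, hgv, Lp.coeFn_smul l (v : Lp ℂ 2 μ)] with x h1 h2 h3
    rw [h1, ← h2]
    exact h3

theorem IsKoopmanRestriction.map_isEigenfunction {S : DiscreteRDS Ω X P} {μ : Measure X}
    {V : Submodule ℂ (Lp ℂ 2 μ)} {L : V →ₗ[ℂ] V} (hL : S.IsKoopmanRestriction μ V L) {l : ℂ}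
    {u : X → ℂ} (hu : S.IsEigenfunction μ V l u) :
    (⟨hu.memLp.toLp u, hu.mem⟩ : V) ≠ 0 ∧
      L ⟨hu.memLp.toLp u, hu.mem⟩ = l • (⟨hu.memLp.toLp u, hu.mem⟩ : V) := by
  constructor
  · intro h0
    refine hu.ne_zero ?_
    have h1 : hu.memLp.toLp u = 0 := congrArg Subtype.val h0
    exact hu.memLp.coeFn_toLp.symm.trans (Lp.eq_zero_iff_ae_eq_zero.1 h1)
  · refine Subtype.ext (Lp.ext ?_)
    filter_upwards [(hL u hu.measurable hu.memLp hu.mem).2, hu.eq, hu.memLp.coeFn_toLp,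
      Lp.coeFn_smul l (hu.memLp.toLp u)] with x h1 h2 h3 h4
    rw [← h1, h2, ← h3]
    exact h4.symm

end DiscreteRDS

/-! ### Cyclic bases -/

/-- If finitely many iterates of `v` span a space of dimension `r`, the first `r` do. -/
theorem LinearMap.top_le_span_iterate {K V : Type*} [Field K] [AddCommGroup V] [Module K V]
    [FiniteDimensional K V] (L : V →ₗ[K] V) (v : V) {r m : ℕ} (hr : Module.finrank K V = r)
    (h : Submodule.span K (Set.range fun k : Fin m => (L ^ k.1) v) = ⊤) :
    ⊤ ≤ Submodule.span K (Set.range fun k : Fin r => (L ^ k.1) v) := by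
  rw [← h, Submodule.span_le]
  rintro _ ⟨k, rfl⟩
  rw [SetLike.mem_coe]
  dsimp only
  -- Cayley–Hamilton: `L ^ k` is a polynomial in `L` of degree less than `r`.
  rw [L.pow_eq_aeval_mod_charpoly]
  set q := (Polynomial.X ^ k.1 %ₘ L.charpoly : Polynomial K) with hq
  rw [Polynomial.aeval_eq_sum_range, LinearMap.sum_apply]
  refine Submodule.sum_mem _ fun i _ => ?_
  by_cases hi : q.coeff i = 0
  · simp [hi]
  · have h1 : i < r := by
      have h2 := Polynomial.degree_modByMonic_lt (Polynomial.X ^ k.1) L.charpoly_monic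
      rw [Polynomial.degree_eq_natDegree L.charpoly_monic.ne_zero, L.charpoly_natDegree, hr] at h2
      exact_mod_cast (Polynomial.le_degree_of_ne_zero hi).trans_lt h2
    exact Submodule.smul_mem _ _ (Submodule.subset_span ⟨⟨i, h1⟩, rfl⟩)

/-! ### Convergence of dynamic mode decomposition -/

namespace DiscreteRDS

open Matrix

variable {Ω X : Type*} [MeasurableSpace Ω] [MeasurableSpace X] {P : Measure Ω}

theorem sum_smul_toLp_ae_eq {μ : Measure X} {ι : Type*} (s : Finset ι) (g : ι → X → ℂ)
    (hg : ∀ j, MemLp (g j) 2 μ) (c : ι → ℂ) :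
    (∑ j ∈ s, c j • (hg j).toLp (g j) : Lp ℂ 2 μ) =ᵐ[μ] fun y => ∑ j ∈ s, c j * g j y := by
  classical
  induction s using Finset.induction_on with
  | empty =>
    simp only [Finset.sum_empty]
    exact Lp.coeFn_zero ℂ 2 μ
  | insert a s ha ih =>
    simp only [Finset.sum_insert ha]
    filter_upwards [ih, Lp.coeFn_add (c a • (hg a).toLp (g a))
      (∑ j ∈ s, c j • (hg j).toLp (g j)), Lp.coeFn_smul (c a) ((hg a).toLp (g a)),
      (hg a).coeFn_toLp] with y h1 h2 h3 h4
    rw [h2, Pi.add_apply, h1, h3, Pi.smul_apply, h4, smul_eq_mul]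

open scoped ComplexOrder in
/-- Convergence of dynamic mode decomposition along a trajectory for which the time averages of
the products of the snapshots converge to their inner products. -/
theorem dmdConverges_of_tendsto {S : DiscreteRDS Ω X P} {μ : Measure X} {f : X → ℂ} {r m : ℕ}
    (hrm : r < m) {V : Submodule ℂ (Lp ℂ 2 μ)} [FiniteDimensional ℂ V] {L : V →ₗ[ℂ] V}
    (hL : S.IsKoopmanRestriction μ V L)
    (hmem : ∀ j : Fin (r + 1), MemLp (S.koopman j f) 2 μ)
    (b : Module.Basis (Fin r) ℂ V)
    (hb : ∀ j, (b j : Lp ℂ 2 μ) = (hmem j.castSucc).toLp (S.koopman j f))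
    (hLb : ∀ j, (L (b j) : Lp ℂ 2 μ) = (hmem j.succ).toLp _) {ω : Ω} {x : X}
    (hlim : ∀ i j : Fin (r + 1), Tendsto
      (fun n : ℕ => (n : ℂ)⁻¹ *
        ((S.hankelCols f ω x n hrm)ᴴ * S.hankelCols f ω x n hrm) i j) atTop
      (𝓝 (inner ℂ ((hmem i).toLp (S.koopman i f)) ((hmem j).toLp (S.koopman j f))))) :
    S.DMDConverges μ f hrm V L ω x := by
  set H := fun n => S.hankelCols f ω x n hrm with hH
  set g : Matrix (Fin (r + 1)) (Fin (r + 1)) ℂ :=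
    Matrix.gram ℂ fun j : Fin (r + 1) => (hmem j).toLp (S.koopman j f) with hg
  have ht : Tendsto (fun n : ℕ => (n : ℂ)⁻¹ • ((H n)ᴴ * H n)) atTop (𝓝 g) :=
    tendsto_pi_nhds.2 fun i => tendsto_pi_nhds.2 fun j => hlim i j
  have hdet : (g.submatrix (Fin.castSucc : Fin r → _) Fin.castSucc).det ≠ 0 := by
    have e : g.submatrix (Fin.castSucc : Fin r → _) Fin.castSucc
        = Matrix.gram ℂ fun j => (b j : Lp ℂ 2 μ) := by
      ext i j; simp only [hb]; rfl
    rw [e]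
    have hli : LinearIndependent ℂ fun j => (b j : Lp ℂ 2 μ) :=
      b.linearIndependent.map' V.subtype V.ker_subtype
    exact ((Matrix.isUnit_iff_isUnit_det _).1
      (Matrix.posDef_gram_of_linearIndependent hli).isUnit).ne_zero
  have hval : ∀ v : V, (v : Lp ℂ 2 μ) = ∑ j, b.repr v j • (b j : Lp ℂ 2 μ) := fun v => by
    conv_lhs => rw [← b.sum_repr v]
    rw [Submodule.coe_sum]
    rfl
  set C := (g.submatrix (Fin.castSucc : Fin r → _) Fin.castSucc)⁻¹ *
    g.submatrix Fin.castSucc Fin.succ with hC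
  -- Pairing the expansion of `L (b j) = 𝒦^(j+1) f` in the basis with each `b i` gives the normal
  -- equations `G * toMatrix b b L = G'`.
  have hCL : LinearMap.toMatrix b b L = C := by
    have e : g.submatrix (Fin.castSucc : Fin r → _) Fin.castSucc * LinearMap.toMatrix b b L
        = g.submatrix Fin.castSucc Fin.succ := by
      ext i j
      rw [mul_apply]
      have h1 : (L (b j) : Lp ℂ 2 μ)
          = ∑ k, LinearMap.toMatrix b b L k j • (b k : Lp ℂ 2 μ) := by
        simp only [LinearMap.toMatrix_apply]
        exact hval _
      simp only [submatrix_apply, hg, gram_apply]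
      rw [← hLb, h1, inner_sum]
      refine Finset.sum_congr rfl fun k _ => ?_
      rw [inner_smul_right, hb, mul_comm]
      rfl
    rw [hC, ← e, nonsing_inv_mul_cancel_left _ _ (isUnit_iff_ne_zero.2 hdet)]
  have hCmul : ∀ v, b.equivFun (L v) = C *ᵥ b.equivFun v := fun v => by
    rw [← hCL]
    exact (LinearMap.toMatrix_mulVec_repr b b L v).symm
  have hCc : DMD.IsCompanion C := DMD.isCompanion_of_shift _ hdet _ fun j hj i => rfl
  have hev := DMD.eventually_det_ne_zero ht hdet
  have htC := DMD.tendsto_leastSquares ht hdet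
  set Cn := fun n => ((DMD.dataX (H n))ᴴ * DMD.dataX (H n))⁻¹ *
    ((DMD.dataX (H n))ᴴ * DMD.dataY (H n)) with hCn
  have hCnc : ∀ᶠ n in atTop, DMD.IsCompanion (Cn n) := by
    filter_upwards [hev] with n hn
    exact DMD.isCompanion_of_shift _ hn _ fun j hj i => rfl
  refine ⟨?_, fun U σ W hsvd => ⟨?_, ?_, ?_⟩⟩
  · filter_upwards [hev] with n hn
    exact ⟨DMD.exists_isSVD _ hn, fun U σ W h => h.pos hn⟩
  · have hchar : ∀ᶠ n in atTop, (Cn n).charpoly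
        = (DMD.rayleigh (DMD.dataY (H n)) (U n) (σ n) (W n)).charpoly := by
      filter_upwards [hev, hsvd] with n hn h
      exact (h.charpoly_rayleigh hn _).symm
    obtain ⟨l, ln, h1, h2, h3⟩ := Polynomial.exists_roots_tendsto (charpoly_monic C)
      (fun n => charpoly_monic (Cn n))
      (fun n => by rw [charpoly_natDegree_eq_dim, Fintype.card_fin])
      (by rw [charpoly_natDegree_eq_dim, Fintype.card_fin])
      (fun i => ((Matrix.continuous_charpoly_coeff i).tendsto C).comp htC)
    refine ⟨l, ln, ?_, ?_, h3⟩
    · rw [← h1, ← hCL, LinearMap.charpoly_toMatrix]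
    · filter_upwards [hchar] with n hn
      rw [← h2 n, ← hn]
  · filter_upwards [hev, hsvd] with n hn h w k
    conv_rhs => rw [← h.mul_mul_invSigma (h.pos hn), ← mulVec_mulVec]
    rw [dmdEigenfunction, mulVec, dotProduct]
    exact Finset.sum_congr rfl fun j _ => mul_comm _ _
  · intro w ln l hw hl
    set c := fun n => (W n * DMD.invSigma (σ n)) *ᵥ w n with hc
    have hcn : ∀ᶠ n in atTop, c n ≠ 0 ∧ Cn n *ᵥ c n = ln n • c n := by
      filter_upwards [hev, hsvd, hw] with n hn h hwn
      exact h.eigenvector hn _ hwn.1 hwn.2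
    constructor
    -- The determinants `det (ln n - Cn n)` vanish for large `n`, hence so does their limit.
    · have hd : (l • (1 : Matrix (Fin r) (Fin r) ℂ) - C).det = 0 := by
        have h1 : Tendsto (fun n => (ln n • (1 : Matrix (Fin r) (Fin r) ℂ) - Cn n).det) atTop
            (𝓝 (l • (1 : Matrix (Fin r) (Fin r) ℂ) - C).det) :=
          (continuous_id.matrix_det.tendsto _).comp ((hl.smul_const _).sub htC)
        refine tendsto_nhds_unique h1 (tendsto_const_nhds.congr' ?_)
        filter_upwards [hcn] with n hn
        refine (Matrix.exists_mulVec_eq_zero_iff.1 ⟨c n, hn.1, ?_⟩).symm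
        rw [sub_mulVec, smul_mulVec, one_mulVec, hn.2, sub_self]
      obtain ⟨d, hd0, hd⟩ := Matrix.exists_mulVec_eq_zero_iff.2 hd
      rw [sub_mulVec, smul_mulVec, one_mulVec, sub_eq_zero] at hd
      refine hL.exists_isEigenfunction (v := b.equivFun.symm d) (l := l) ?_ ?_
      · exact (LinearEquiv.map_ne_zero_iff _).2 hd0
      · apply b.equivFun.injective
        rw [hCmul, map_smul, LinearEquiv.apply_symm_apply, hd]
    · intro u hu
      obtain ⟨hv0, hv⟩ := hL.map_isEigenfunction hu
      set v : V := ⟨hu.memLp.toLp u, hu.mem⟩ with hvdef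
      have hd0 : b.equivFun v ≠ 0 := (LinearEquiv.map_ne_zero_iff _).2 hv0
      have hd : C *ᵥ b.equivFun v = l • b.equivFun v := by rw [← hCmul, hv, map_smul]
      obtain ⟨a, ha0, ha⟩ :=
        DMD.exists_tendsto_smul_eigenvector hCnc hCc htC hcn hl hd0 hd
      refine ⟨a, ha0, ?_⟩
      -- Coordinates in the fixed basis `b` converge, which gives convergence in `L²`.
      have hF : Tendsto (fun n => ∑ j, (a n * c n j) • (b j : Lp ℂ 2 μ)) atTop
          (𝓝 (v : Lp ℂ 2 μ)) := by
        rw [hval v]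
        exact tendsto_finsetSum _ fun j _ => (tendsto_pi_nhds.1 ha j).smul_const _
      rw [tendsto_iff_edist_tendsto_0] at hF
      refine hF.congr fun n => ?_
      rw [Lp.edist_def]
      refine eLpNorm_congr_ae ?_
      simp only [hb]
      filter_upwards [sum_smul_toLp_ae_eq Finset.univ (fun j : Fin r => S.koopman j f)
        (fun j => hmem j.castSucc) (fun j => a n * c n j), hu.memLp.coeFn_toLp] with y h1 h2
      rw [Pi.sub_apply, hvdef, h2]
      refine congrArg (· - u y) (h1.trans ?_)
      rw [dmdEigenfunction, Finset.mul_sum]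
      exact Finset.sum_congr rfl fun j _ => mul_assoc _ _ _

/-- The time averages of products of the snapshots converge to the inner products. -/
theorem IsErgodic.ae_tendsto_hankelCols [IsProbabilityMeasure P] {S : DiscreteRDS Ω X P}
    {ν : Measure (Ω × X)} (hν : S.IsErgodic ν) {f : X → ℂ} (hf : Measurable f) {r m : ℕ}
    (hrm : r < m) (hmem : ∀ j : Fin (r + 1), MemLp (S.koopman j f) 2 ν.snd) :
    ∀ᵐ p ∂ν, ∀ i j : Fin (r + 1), Tendsto
      (fun n : ℕ => (n : ℂ)⁻¹ *
        ((S.hankelCols f p.1 p.2 n hrm)ᴴ * S.hankelCols f p.1 p.2 n hrm) i j) atTop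
      (𝓝 (inner ℂ ((hmem i).toLp (S.koopman i f)) ((hmem j).toLp (S.koopman j f)))) := by
  have := hν.isProbabilityMeasure
  refine ae_all_iff.2 fun i => ae_all_iff.2 fun j => ?_
  set h : X → ℂ := fun y => star (S.koopman i f y) * S.koopman j f y with hh
  have hm : Measurable h :=
    (continuous_star.measurable.comp (S.measurable_koopman i hf)).mul (S.measurable_koopman j hf)
  have hin : (fun y => inner ℂ ((hmem i).toLp (S.koopman i f) y)
      ((hmem j).toLp (S.koopman j f) y)) =ᵐ[ν.snd] h := by
    filter_upwards [(hmem i).coeFn_toLp, (hmem j).coeFn_toLp] with y h1 h2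
    rw [h1, h2, RCLike.inner_apply, mul_comm]; rfl
  have hi : Integrable h ν.snd :=
    (L2.integrable_inner (𝕜 := ℂ) ((hmem i).toLp _) ((hmem j).toLp _)).congr hin
  have hi' : Integrable (fun p : Ω × X => h p.2) ν :=
    (integrable_map_measure hm.aestronglyMeasurable measurable_snd.aemeasurable).1 hi
  have hint : ∫ p : Ω × X, h p.2 ∂ν
      = inner ℂ ((hmem i).toLp (S.koopman i f)) ((hmem j).toLp (S.koopman j f)) := by
    rw [L2.inner_def, integral_congr_ae hin, Measure.snd,
      integral_map measurable_snd.aemeasurable hm.aestronglyMeasurable]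
  -- The observable depends only on the second component, so its Birkhoff sums along the skew
  -- product are sums over the trajectory `φ(k, ω) x`, that is, entries of `Hᴴ H`.
  filter_upwards [hν.ergodic_skew.ae_tendsto_birkhoffAverage (hm.comp measurable_snd) hi']
    with p hp
  rw [← hint]
  refine hp.congr fun n => ?_
  congr 1
  rw [mul_apply, birkhoffSum, ← Fin.sum_univ_eq_sum_range
    (fun k => (h ∘ Prod.snd) (S.skew^[k] p))]
  refine Finset.sum_congr rfl fun k _ => ?_
  rw [skew_iterate]
  rfl

/-- The first `r` functions `f, 𝒦 f, …, 𝒦^{r-1} f` form a basis of the `r`-dimensional invariant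
Krylov space. -/
theorem exists_basis_krylov [IsProbabilityMeasure P] {S : DiscreteRDS Ω X P} {μ : Measure X}
    (hMarkov : S.IsMarkovFamily) {f : X → ℂ} (hf : Measurable f) {r m : ℕ} (hrm : r < m)
    (hdef : ∀ k < m, S.KoopmanDefined μ k f) (hL2 : ∀ k : Fin m, MemLp (S.koopman k f) 2 μ)
    (hdim : Module.finrank ℂ (S.krylov μ f m hL2) = r)
    {L : S.krylov μ f m hL2 →ₗ[ℂ] S.krylov μ f m hL2}
    (hL : S.IsKoopmanRestriction μ (S.krylov μ f m hL2) L) :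
    ∃ b : Module.Basis (Fin r) ℂ (S.krylov μ f m hL2),
      (∀ j : Fin r, (b j : Lp ℂ 2 μ) = (hL2 ⟨j, j.2.trans hrm⟩).toLp (S.koopman j f)) ∧
      ∀ j : Fin r, (L (b j) : Lp ℂ 2 μ)
        = (hL2 ⟨j + 1, (Nat.succ_le_of_lt j.2).trans_lt hrm⟩).toLp (S.koopman (j + 1) f) := by
  have hV : ∀ k : Fin m, (hL2 k).toLp (S.koopman k f) ∈ S.krylov μ f m hL2 :=
    fun k => Submodule.subset_span ⟨k, rfl⟩
  set v : Fin m → S.krylov μ f m hL2 := fun k => ⟨(hL2 k).toLp (S.koopman k f), hV k⟩ with hv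
  -- The semigroup law `𝒦 (𝒦^k f) = 𝒦^(1+k) f` holds wherever the expectation defining the right
  -- side exists, which is almost everywhere for `k + 1 < m`.
  have hsucc : ∀ (k : ℕ) (hk : k + 1 < m), L (v ⟨k, k.lt_succ_self.trans hk⟩) = v ⟨k + 1, hk⟩ := by
    intro k hk
    refine Subtype.ext (Lp.ext ?_)
    have h1 := (hL (S.koopman k f) (S.measurable_koopman k hf)
      (hL2 ⟨k, k.lt_succ_self.trans hk⟩) (hV ⟨k, k.lt_succ_self.trans hk⟩)).2
    filter_upwards [h1, hdef (k + 1) hk, (hL2 ⟨k + 1, hk⟩).coeFn_toLp] with y h2 h3 h4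
    rw [← h2, h4, add_comm k 1]
    rw [add_comm k 1] at h3
    exact hMarkov.koopman_koopman 1 k hf h3
  have h0 : 0 < m := (Nat.zero_le r).trans_lt hrm
  have hpow : ∀ (k : ℕ) (hk : k < m), (L ^ k) (v ⟨0, h0⟩) = v ⟨k, hk⟩ := by
    intro k
    induction k with
    | zero => intro _; rfl
    | succ k ih =>
      intro hk
      rw [pow_succ', Module.End.mul_apply, ih (k.lt_succ_self.trans hk), hsucc]
  have hspan : Submodule.span ℂ (Set.range fun k : Fin m => (L ^ k.1) (v ⟨0, h0⟩)) = ⊤ := by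
    have e : (fun k : Fin m => (L ^ k.1) (v ⟨0, h0⟩)) = v := funext fun k => hpow k k.2
    rw [e]
    apply Submodule.map_injective_of_injective (S.krylov μ f m hL2).subtype_injective
    rw [Submodule.map_span, Submodule.map_subtype_top, ← Set.range_comp]
    rfl
  refine ⟨basisOfTopLeSpanOfCardEqFinrank (fun k : Fin r => (L ^ k.1) (v ⟨0, h0⟩))
    (L.top_le_span_iterate _ hdim hspan) (by rw [hdim, Fintype.card_fin]), fun j => ?_, fun j => ?_⟩
  · rw [coe_basisOfTopLeSpanOfCardEqFinrank, hpow j (j.2.trans hrm)]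
  · rw [coe_basisOfTopLeSpanOfCardEqFinrank, hpow j (j.2.trans hrm),
      hsucc j ((Nat.succ_le_of_lt j.2).trans_lt hrm)]

end DiscreteRDS

theorem mainTheorem1
    {Ω M : Type*} [MeasurableSpace Ω] (P : Measure Ω) [IsProbabilityMeasure P]
    [TopologicalSpace M] [PolishSpace M] [MeasurableSpace M] [BorelSpace M]
    (A : Set M) (hA : IsCompact A)
    (S : DiscreteRDS Ω A P)
    (ν : Measure (Ω × A)) (hν : S.IsErgodic ν) (hMarkov : S.IsMarkovFamily)
    (μ : Measure A) (hμ : μ = ν.snd)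
    (f : A → ℂ) (hf : Measurable f) (r m : ℕ) (hrm : r < m)
    (hdef : ∀ k < m, S.KoopmanDefined μ k f)
    (hL2 : ∀ k : Fin m, MemLp (S.koopman k f) 2 μ)
    (hdim : Module.finrank ℂ (S.krylov μ f m hL2) = r)
    (hinv : S.KoopmanInvariant μ (S.krylov μ f m hL2)) :
    (∀ᵐ p ∂ν, S.DMDConverges μ f hrm (S.krylov μ f m hL2)
      (S.koopmanRestriction μ hinv) p.1 p.2) ∧
    (∀ κ : Kernel A Ω, IsMarkovKernel κ → (μ ⊗ₘ κ).map Prod.swap = ν →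
      ∀ᵐ x ∂μ, ∀ᵐ ω ∂(κ x), S.DMDConverges μ f hrm (S.krylov μ f m hL2)
        (S.koopmanRestriction μ hinv) ω x) := by
  subst hμ
  have := hν.isProbabilityMeasure
  have hL := S.koopmanRestriction_spec ν.snd hinv
  obtain ⟨b, hb, hLb⟩ := DiscreteRDS.exists_basis_krylov hMarkov hf hrm hdef hL2 hdim hL
  -- The Hankel columns go up to `𝒦^r f`, which is among the functions assumed in `L²` because `r <
  -- m`.
  have hmem : ∀ j : Fin (r + 1), MemLp (S.koopman j f) 2 ν.snd :=
    fun j => hL2 ⟨j, (Nat.lt_succ_iff.1 j.2).trans_lt hrm⟩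
  have main : ∀ᵐ p ∂ν, S.DMDConverges ν.snd f hrm (S.krylov ν.snd f m hL2)
      (S.koopmanRestriction ν.snd hinv) p.1 p.2 := by
    filter_upwards [hν.ae_tendsto_hankelCols hf hrm hmem] with p hp
    exact DiscreteRDS.dmdConverges_of_tendsto hrm hL hmem b hb hLb hp
  refine ⟨main, fun κ hκ hκν => ?_⟩
  have hmap : ∀ᵐ p ∂((ν.snd ⊗ₘ κ).map Prod.swap), S.DMDConverges ν.snd f hrm
      (S.krylov ν.snd f m hL2) (S.koopmanRestriction ν.snd hinv) p.1 p.2 := by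
    rw [hκν]; exact main
  -- Disintegrating `ν` over its marginal on `A` turns the almost sure statement into one for almost
  -- every starting point.
  exact Measure.ae_ae_of_ae_compProd (ae_of_ae_map measurable_swap.aemeasurable hmap)
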